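/- Let $H$ be a separable complex Hilbert space with a fixed orthonormal basis, let $b\mapsto b^t$ be the transpose map on $B(H)$ with respect to this basis, let $\mathcal T(H)$ be the trace class operators on $H$ with the trace norm, and let $\mathrm{Tr}$ be the usual trace. For a norm closed unital $*$-subalgebra $B\subseteq B(H)$ let $B\mathbin{\widehat\otimes}\mathcal T(H)$ be the projective tensor product. For a bounded linear map $\phi\colon B\to B(H)$ let $\tilde\phi\in (B\mathbin{\widehat\otimes}\mathcal T(H))^*$ be the functional determined by $$\tilde\phi(a\otimes b)=\mathrm{Tr}(\phi(a)b^t),\qquad a\in B,\ b\in \mathcal T(H).$$ Let $S_0$ be the set of all finite sums $\sum_i c_i\,\sigma_i\otimes\omega_i$ with $c_i\ge 0$, $\sigma_i$ a state of $B$, and $\omega_i$ a normal state of $B(H)$ (restricted to $\mathcal T(H)$). A functional in $(B\mathbin{\widehat\otimes}\mathcal T(H))^*$ is called separable if it belongs to the weak$^*$ closure of $S_0$, that is, to the bipolar cone $S_0^{**}$ with respect to the duality with $B\mathbin{\widehat\otimes}\mathcal T(H)$. Let $A\subseteq B\subseteq B(H)$ be C*-algebras containing the identity of $B(H)$, and let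 $\phi\colon B\to A$ be a conditional expectation, i.e. a bounded positive linear map with $\phi(a)=a$ and $\phi(abc)=a\phi(b)c$ for $a,c\in A$, $b\in B$. Then $\tilde\phi$ is separable if and only if $A$ is abelian. If moreover $H$ is finite dimensional, then the same equivalence holds with the norm closure of $S_0$ in place of the weak$^*$ closure. -/

import Mathlib

open scoped InnerProductSpace TensorProduct

set_option linter.unusedSectionVars false

noncomputable section

namespace SepMap

/-! ### Trace class operators -/

section TraceClass

variable {H : Type*} [NormedAddCommGroup H] [InnerProductSpace ℂ H]

/-- `b = ∑ₙ |yₙ⟩⟨xₙ|` (strongly) with `∑ₙ ‖xₙ‖ ‖yₙ‖ < ∞`. -/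
structure IsTraceRep (b : H →L[ℂ] H) (x y : ℕ → H) : Prop where
  summable : Summable fun n => ‖x n‖ * ‖y n‖
  hasSum : ∀ v, HasSum (fun n => ⟪x n, v⟫_ℂ • y n) (b v)

/-- Trace class operators, as the nuclear operators of the Hilbert space `H`. -/
def IsTraceClass (b : H →L[ℂ] H) : Prop := ∃ x y, IsTraceRep b x y

/-- The cost of the expansion `∑ₙ |yₙ⟩⟨xₙ|`. -/
def repCost (x y : ℕ → H) : ℝ := ∑' n, ‖x n‖ * ‖y n‖

theorem repCost_nonneg (x y : ℕ → H) : 0 ≤ repCost x y :=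
  tsum_nonneg fun _ => by positivity

theorem IsTraceRep.zero : IsTraceRep (0 : H →L[ℂ] H) 0 0 :=
  ⟨by simp [summable_zero], fun v => by simp [hasSum_zero]⟩

theorem IsTraceRep.smul {b : H →L[ℂ] H} {x y : ℕ → H} (h : IsTraceRep b x y) (c : ℂ) :
    IsTraceRep (c • b) x (fun n => c • y n) := by
  refine ⟨?_, fun v => ?_⟩
  · have := h.summable.mul_left ‖c‖
    refine this.congr fun n => ?_
    rw [norm_smul]; ring
  · have := (h.hasSum v).const_smul c
    simpa only [smul_comm c] using! this

theorem repCost_smul (c : ℂ) (x y : ℕ → H) :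
    repCost x (fun n => c • y n) = ‖c‖ * repCost x y := by
  simp only [repCost, norm_smul, ← tsum_mul_left]
  exact tsum_congr fun n => by ring

/-- Interleaving of two sequences. -/
def interleave (x x' : ℕ → H) : ℕ → H := Sum.elim x x' ∘ Equiv.natSumNatEquivNat.symm

theorem IsTraceRep.add_aux {b b' : H →L[ℂ] H} {x y x' y' : ℕ → H} (h : IsTraceRep b x y)
    (h' : IsTraceRep b' x' y') :
    IsTraceRep (b + b') (interleave x x') (interleave y y') ∧
      repCost (interleave x x') (interleave y y') = repCost x y + repCost x' y' := by
  have key : HasSum (fun n => ‖interleave x x' n‖ * ‖interleave y y' n‖)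
      (repCost x y + repCost x' y') := by
    rw [← Equiv.natSumNatEquivNat.hasSum_iff]
    refine HasSum.sum ?_ ?_
    · simpa [interleave, Function.comp_def] using! h.summable.hasSum
    · simpa [interleave, Function.comp_def] using! h'.summable.hasSum
  refine ⟨⟨key.summable, fun v => ?_⟩, key.tsum_eq⟩
  rw [← Equiv.natSumNatEquivNat.hasSum_iff]
  refine HasSum.sum ?_ ?_
  · simpa [interleave, Function.comp_def] using! h.hasSum v
  · simpa [interleave, Function.comp_def] using! h'.hasSum v

theorem IsTraceRep.norm_le {b : H →L[ℂ] H} {x y : ℕ → H} (h : IsTraceRep b x y) :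
    ‖b‖ ≤ repCost x y := by
  refine ContinuousLinearMap.opNorm_le_bound _ (repCost_nonneg x y) fun v => ?_
  rw [← (h.hasSum v).tsum_eq, repCost, ← tsum_mul_right]
  refine tsum_of_norm_bounded (h.summable.mul_right ‖v‖).hasSum fun n => ?_
  rw [norm_smul]
  calc ‖⟪x n, v⟫_ℂ‖ * ‖y n‖ ≤ (‖x n‖ * ‖v‖) * ‖y n‖ := by
        gcongr; exact norm_inner_le_norm _ _
    _ = ‖x n‖ * ‖y n‖ * ‖v‖ := by ring

theorem IsTraceRep.comp_left {b : H →L[ℂ] H} {x y : ℕ → H} (h : IsTraceRep b x y)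
    (a : H →L[ℂ] H) : IsTraceRep (a ∘L b) x (fun n => a (y n)) := by
  refine ⟨?_, fun v => ?_⟩
  · refine Summable.of_nonneg_of_le (fun n => by positivity) (fun n => ?_)
      (h.summable.mul_left ‖a‖)
    calc ‖x n‖ * ‖a (y n)‖ ≤ ‖x n‖ * (‖a‖ * ‖y n‖) := by gcongr; exact a.le_opNorm _
      _ = _ := by ring
  · simpa using a.hasSum (h.hasSum v)

variable (H) in
/-- The space `T(H)` of trace class operators on `H`. -/
def traceClassSubmodule : Submodule ℂ (H →L[ℂ] H) where
  carrier := {b | IsTraceClass b}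
  zero_mem' := ⟨0, 0, IsTraceRep.zero⟩
  add_mem' := by
    rintro b b' ⟨x, y, h⟩ ⟨x', y', h'⟩
    exact ⟨_, _, (h.add_aux h').1⟩
  smul_mem' := by
    rintro c b ⟨x, y, h⟩
    exact ⟨_, _, h.smul c⟩

variable (H) in
/-- The space `T(H)` of trace class operators on `H`, to be equipped with the trace norm. -/
def TraceClass : Type _ := traceClassSubmodule H

namespace TraceClass

instance : AddCommGroup (TraceClass H) := inferInstanceAs (AddCommGroup (traceClassSubmodule H))

instance : Module ℂ (TraceClass H) := inferInstanceAs (Module ℂ (traceClassSubmodule H))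

/-- The inclusion of `T(H)` into `B(H)`. -/
def toCLM : TraceClass H →ₗ[ℂ] (H →L[ℂ] H) := (traceClassSubmodule H).subtype

theorem toCLM_injective : Function.Injective (toCLM (H := H)) := Subtype.val_injective

theorem isTraceClass (b : TraceClass H) : IsTraceClass b.toCLM := b.2

/-- The set of the numbers `∑ₙ ‖xₙ‖ ‖yₙ‖`, over all expansions `b = ∑ₙ |yₙ⟩⟨xₙ|`. -/
def costs (b : TraceClass H) : Set ℝ := {s | ∃ x y, IsTraceRep b.toCLM x y ∧ repCost x y = s}

/-- The trace norm `‖b‖₁ = inf {∑ₙ ‖xₙ‖ ‖yₙ‖ : b = ∑ₙ |yₙ⟩⟨xₙ|}`. -/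
instance : Norm (TraceClass H) := ⟨fun b => sInf b.costs⟩

theorem norm_def (b : TraceClass H) : ‖b‖ = sInf b.costs := rfl

theorem costs_nonempty (b : TraceClass H) : b.costs.Nonempty := by
  obtain ⟨x, y, h⟩ := b.isTraceClass
  exact ⟨_, x, y, h, rfl⟩

theorem costs_bddBelow (b : TraceClass H) : BddBelow b.costs := by
  refine ⟨0, ?_⟩
  rintro _ ⟨x, y, -, rfl⟩
  exact repCost_nonneg x y

theorem norm_le_repCost {b : TraceClass H} {x y : ℕ → H} (h : IsTraceRep b.toCLM x y) :
    ‖b‖ ≤ repCost x y := csInf_le b.costs_bddBelow ⟨x, y, h, rfl⟩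

theorem le_mul_norm {b : TraceClass H} {r C : ℝ} (hC : 0 ≤ C)
    (h : ∀ x y, IsTraceRep b.toCLM x y → r ≤ C * repCost x y) : r ≤ C * ‖b‖ := by
  rw [norm_def, ← smul_eq_mul, ← Real.sInf_smul_of_nonneg hC]
  refine le_csInf (b.costs_nonempty.image _) ?_
  rintro _ ⟨_, ⟨x, y, hxy, rfl⟩, rfl⟩
  exact h x y hxy

theorem norm_toCLM_le (b : TraceClass H) : ‖b.toCLM‖ ≤ ‖b‖ := by
  simpa using le_mul_norm (b := b) zero_le_one fun x y h => by simpa using h.norm_le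

theorem norm_smul_le' (c : ℂ) (b : TraceClass H) : ‖c • b‖ ≤ ‖c‖ * ‖b‖ := by
  refine le_mul_norm (norm_nonneg c) fun x y h => ?_
  rw [← repCost_smul]
  exact norm_le_repCost (by simpa using h.smul c)

theorem core : NormedSpace.Core ℂ (TraceClass H) where
  norm_nonneg b := (norm_nonneg _).trans (norm_toCLM_le b)
  norm_smul c b := by
    refine le_antisymm (norm_smul_le' c b) ?_
    rcases eq_or_ne c 0 with rfl | hc
    · simpa using (norm_nonneg _).trans (norm_toCLM_le (0 : TraceClass H))
    · have := norm_smul_le' c⁻¹ (c • b)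
      rw [inv_smul_smul₀ hc, norm_inv] at this
      have hc' : 0 < ‖c‖ := norm_pos_iff.2 hc
      calc ‖c‖ * ‖b‖ ≤ ‖c‖ * (‖c‖⁻¹ * ‖c • b‖) := by gcongr
        _ = ‖c • b‖ := by field_simp
  norm_triangle b b' := by
    refine le_of_forall_pos_lt_add fun ε hε => ?_
    obtain ⟨_, ⟨x, y, h, rfl⟩, hs⟩ := Real.lt_sInf_add_pos b.costs_nonempty (half_pos hε)
    obtain ⟨_, ⟨x', y', h', rfl⟩, hs'⟩ := Real.lt_sInf_add_pos b'.costs_nonempty (half_pos hε)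
    have h1 := h.add_aux h'
    have h2 : ‖b + b'‖ ≤ repCost x y + repCost x' y' := by
      rw [← h1.2]
      exact norm_le_repCost (by simpa using h1.1)
    rw [norm_def b, norm_def b']
    linarith
  norm_eq_zero_iff b := by
    constructor
    · intro h
      have := norm_toCLM_le b
      rw [h] at this
      exact toCLM_injective (by simpa using norm_le_zero_iff.1 this)
    · rintro rfl
      refine le_antisymm ?_ ((norm_nonneg _).trans (norm_toCLM_le _))
      have h0 : IsTraceRep (toCLM (0 : TraceClass H)) 0 0 := by simpa using IsTraceRep.zero
      exact (norm_le_repCost h0).trans (by simp [repCost])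

instance : NormedAddCommGroup (TraceClass H) := NormedAddCommGroup.ofCore core

instance : NormedSpace ℂ (TraceClass H) := NormedSpace.ofCore core

/-- The inclusion of `T(H)` into `B(H)` as a bounded map. -/
def toCLML : TraceClass H →L[ℂ] (H →L[ℂ] H) :=
  LinearMap.mkContinuous toCLM 1 fun b => by simpa using norm_toCLM_le b

end TraceClass

end TraceClass

/-! ### Trace and transpose -/

section TraceTranspose

variable {H ι : Type*} [NormedAddCommGroup H] [InnerProductSpace ℂ H]

/-- The trace `Tr b = ∑ᵢ ⟨eᵢ, b eᵢ⟩` (an absolutely convergent sum when `b` is trace class). -/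
def trace (e : HilbertBasis ι ℂ H) (b : H →L[ℂ] H) : ℂ := ∑' i, ⟪e i, b (e i)⟫_ℂ

theorem summable_inner_mul_inner_norm (e : HilbertBasis ι ℂ H) (x y : H) :
    (Summable fun i => ‖⟪x, e i⟫_ℂ * ⟪e i, y⟫_ℂ‖) ∧
      ∑' i, ‖⟪x, e i⟫_ℂ * ⟪e i, y⟫_ℂ‖ ≤ ‖x‖ * ‖y‖ := by
  have hs : Summable fun i => ‖⟪x, e i⟫_ℂ * ⟪e i, y⟫_ℂ‖ :=
    (e.summable_inner_mul_inner x y).norm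
  refine ⟨hs, hs.tsum_le_of_sum_le fun s => ?_⟩
  have hx := e.orthonormal.sum_inner_products_le x (s := s)
  have hy := e.orthonormal.sum_inner_products_le y (s := s)
  simp only [norm_mul, norm_inner_symm x]
  have hcs := Finset.sum_mul_sq_le_sq_mul_sq s (fun i => ‖⟪e i, x⟫_ℂ‖) (fun i => ‖⟪e i, y⟫_ℂ‖)
  refine le_of_sq_le_sq ?_ (by positivity)
  refine hcs.trans ?_
  rw [mul_pow]
  exact mul_le_mul hx hy (Finset.sum_nonneg fun _ _ => by positivity) (by positivity)

theorem IsTraceRep.trace_spec {b : H →L[ℂ] H} {x y : ℕ → H} (h : IsTraceRep b x y)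
    (e : HilbertBasis ι ℂ H) :
    (Summable fun i => ⟪e i, b (e i)⟫_ℂ) ∧ trace e b = ∑' n, ⟪x n, y n⟫_ℂ := by
  have hS : Summable fun p : ℕ × ι => ‖⟪x p.1, e p.2⟫_ℂ * ⟪e p.2, y p.1⟫_ℂ‖ := by
    rw [summable_prod_of_nonneg fun _ => norm_nonneg _]
    refine ⟨fun n => (summable_inner_mul_inner_norm e (x n) (y n)).1, ?_⟩
    exact Summable.of_nonneg_of_le (fun n => tsum_nonneg fun _ => norm_nonneg _)
      (fun n => (summable_inner_mul_inner_norm e (x n) (y n)).2) h.summable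
  have hS' : Summable fun p : ℕ × ι => ⟪x p.1, e p.2⟫_ℂ * ⟪e p.2, y p.1⟫_ℂ := hS.of_norm
  have hb : ∀ i, ∑' n, ⟪x n, e i⟫_ℂ * ⟪e i, y n⟫_ℂ = ⟪e i, b (e i)⟫_ℂ := fun i => by
    have := (innerSL ℂ (e i)).hasSum (h.hasSum (e i))
    simpa [inner_smul_right] using this.tsum_eq
  constructor
  · have := ((Equiv.prodComm ι ℕ).summable_iff.2 hS').prod
    exact this.congr fun i => (hb i).symm ▸ rfl
  · rw [trace]
    simp only [← hb]
    rw [Summable.tsum_comm (f := fun n i => ⟪x n, e i⟫_ℂ * ⟪e i, y n⟫_ℂ) hS']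
    exact tsum_congr fun n => e.tsum_inner_mul_inner (x n) (y n)

theorem IsTraceRep.norm_trace_le {b : H →L[ℂ] H} {x y : ℕ → H} (h : IsTraceRep b x y)
    (e : HilbertBasis ι ℂ H) : ‖trace e b‖ ≤ repCost x y := by
  rw [(h.trace_spec e).2]
  exact tsum_of_norm_bounded h.summable.hasSum fun n => norm_inner_le_norm _ _

/-- Complex conjugation `∑ᵢ cᵢ eᵢ ↦ ∑ᵢ c̄ᵢ eᵢ` in the basis `e`. -/
def conj (e : HilbertBasis ι ℂ H) : H →L⋆[ℂ] H :=
  (e.repr.symm.toContinuousLinearEquiv : _ →L[ℂ] H).comp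
    (((starₗᵢ ℂ : lp (fun _ : ι => ℂ) 2 ≃ₗᵢ⋆[ℂ] lp (fun _ : ι => ℂ) 2).toContinuousLinearEquiv :
      lp (fun _ : ι => ℂ) 2 →L⋆[ℂ] lp (fun _ : ι => ℂ) 2).comp
        (e.repr.toContinuousLinearEquiv : H →L[ℂ] _))

theorem inner_basis_conj (e : HilbertBasis ι ℂ H) (v : H) (i : ι) :
    ⟪e i, conj e v⟫_ℂ = star ⟪e i, v⟫_ℂ := by
  rw [← e.repr_apply_apply, ← e.repr_apply_apply]
  simp [conj]

theorem inner_conj_conj (e : HilbertBasis ι ℂ H) (v w : H) :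
    ⟪conj e v, conj e w⟫_ℂ = ⟪w, v⟫_ℂ := by
  rw [← e.tsum_inner_mul_inner, ← e.tsum_inner_mul_inner]
  refine tsum_congr fun i => ?_
  rw [← inner_conj_symm (conj e v), inner_basis_conj, inner_basis_conj, mul_comm,
    ← inner_conj_symm w]
  simp

theorem conj_conj (e : HilbertBasis ι ℂ H) (v : H) : conj e (conj e v) = v := by
  simp [conj]

theorem norm_conj (e : HilbertBasis ι ℂ H) (v : H) : ‖conj e v‖ = ‖v‖ := by
  simp [conj]

variable [CompleteSpace H]

/-- The transpose of `b` with respect to the orthonormal basis `e`; see `inner_transpose`. -/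
def transpose (e : HilbertBasis ι ℂ H) (b : H →L[ℂ] H) : H →L[ℂ] H :=
  (conj e).comp (b.adjoint.comp (conj e))

theorem inner_transpose (e : HilbertBasis ι ℂ H) (b : H →L[ℂ] H) (i j : ι) :
    ⟪e i, transpose e b (e j)⟫_ℂ = ⟪e j, b (e i)⟫_ℂ := by
  have he : ∀ k, conj e (e k) = e k := fun k => by
    apply e.repr.injective
    ext l
    classical
    rw [e.repr_apply_apply, e.repr_apply_apply, inner_basis_conj,
      orthonormal_iff_ite.1 e.orthonormal]
    split_ifs <;> simp
  rw [← he i]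
  simp only [transpose, ContinuousLinearMap.comp_apply]
  rw [inner_conj_conj, he, he, ContinuousLinearMap.adjoint_inner_left]

theorem transpose_add (e : HilbertBasis ι ℂ H) (b c : H →L[ℂ] H) :
    transpose e (b + c) = transpose e b + transpose e c := by
  ext v; simp [transpose]

theorem transpose_smul (e : HilbertBasis ι ℂ H) (c : ℂ) (b : H →L[ℂ] H) :
    transpose e (c • b) = c • transpose e b := by
  have : (c • b).adjoint = (starRingEnd ℂ c) • b.adjoint := map_smulₛₗ _ c b
  ext v; simp [transpose, this]

theorem IsTraceRep.transpose {b : H →L[ℂ] H} {x y : ℕ → H} (h : IsTraceRep b x y)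
    (e : HilbertBasis ι ℂ H) :
    IsTraceRep (transpose e b) (fun n => conj e (y n)) (fun n => conj e (x n)) := by
  have hs : Summable fun n => ‖y n‖ * ‖x n‖ := h.summable.congr fun n => mul_comm _ _
  have hadj : ∀ v, HasSum (fun n => ⟪y n, v⟫_ℂ • x n) (b.adjoint v) := fun v => by
    have hsum : Summable fun n => ⟪y n, v⟫_ℂ • x n := by
      refine Summable.of_norm_bounded (hs.mul_right ‖v‖) fun n => ?_
      rw [norm_smul]
      calc ‖⟪y n, v⟫_ℂ‖ * ‖x n‖ ≤ (‖y n‖ * ‖v‖) * ‖x n‖ := by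
            gcongr; exact norm_inner_le_norm _ _
        _ = ‖y n‖ * ‖x n‖ * ‖v‖ := by ring
    convert hsum.hasSum using 1
    refine ext_inner_left ℂ fun w => ?_
    rw [ContinuousLinearMap.adjoint_inner_right]
    have h1 := (innerSL ℂ w).hasSum hsum.hasSum
    have h2 := (innerSLFlip ℂ v).hasSum (h.hasSum w)
    have h3 := h1.tsum_eq
    have h4 := h2.tsum_eq
    simp only [innerSL_apply_apply, innerSLFlip_apply_apply] at h3 h4
    rw [← h3, ← h4]
    refine tsum_congr fun n => ?_
    rw [inner_smul_left, inner_smul_right, inner_conj_symm, mul_comm]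
  refine ⟨by simpa only [norm_conj] using hs, fun v => ?_⟩
  have := (conj e).hasSum (hadj (conj e v))
  have hv : ∀ n, ⟪conj e (y n), v⟫_ℂ = starRingEnd ℂ ⟪y n, conj e v⟫_ℂ := fun n => by
    conv_lhs => rw [← conj_conj e v]
    rw [inner_conj_conj, inner_conj_symm]
  simpa only [map_smulₛₗ, hv] using! this

theorem repCost_transpose (e : HilbertBasis ι ℂ H) (x y : ℕ → H) :
    repCost (fun n => conj e (y n)) (fun n => conj e (x n)) = repCost x y := by
  simp only [repCost, norm_conj, mul_comm]

end TraceTranspose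

/-! ### The projective tensor product -/

section Projective

variable (E F : Type*) [SeminormedAddCommGroup E] [NormedSpace ℂ E]
  [SeminormedAddCommGroup F] [NormedSpace ℂ F]

/-- The algebraic tensor product `E ⊙ F`, to be equipped with the projective norm. -/
def AlgTensor : Type _ := E ⊗[ℂ] F

namespace AlgTensor

instance : AddCommGroup (AlgTensor E F) := inferInstanceAs (AddCommGroup (E ⊗[ℂ] F))

instance : Module ℂ (AlgTensor E F) := inferInstanceAs (Module ℂ (E ⊗[ℂ] F))

variable {E F}

/-- The elementary tensor `a ⊗ b`. -/
def tmul (a : E) (b : F) : AlgTensor E F := a ⊗ₜ[ℂ] b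

/-- The set of the numbers `∑ᵢ ‖aᵢ‖ ‖bᵢ‖`, over all expansions `x = ∑ᵢ aᵢ ⊗ bᵢ`. -/
def costs (x : AlgTensor E F) : Set ℝ :=
  {s | ∃ (n : ℕ) (a : Fin n → E) (b : Fin n → F),
    x = ∑ i, tmul (a i) (b i) ∧ s = ∑ i, ‖a i‖ * ‖b i‖}

/-- The projective norm. -/
instance : Norm (AlgTensor E F) := ⟨fun x => sInf x.costs⟩

theorem norm_def (x : AlgTensor E F) : ‖x‖ = sInf x.costs := rfl

theorem costs_nonneg {x : AlgTensor E F} {s : ℝ} (hs : s ∈ x.costs) : 0 ≤ s := by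
  obtain ⟨n, a, b, -, rfl⟩ := hs
  exact Finset.sum_nonneg fun i _ => by positivity

theorem costs_bddBelow (x : AlgTensor E F) : BddBelow x.costs := ⟨0, fun _ => costs_nonneg⟩

theorem costs_add {x x' : AlgTensor E F} {s s' : ℝ} (hs : s ∈ x.costs) (hs' : s' ∈ x'.costs) :
    s + s' ∈ (x + x').costs := by
  obtain ⟨n, a, b, rfl, rfl⟩ := hs
  obtain ⟨n', a', b', rfl, rfl⟩ := hs'
  exact ⟨n + n', Fin.append a a', Fin.append b b', by simp [Fin.sum_univ_add],
    by simp [Fin.sum_univ_add]⟩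

theorem costs_smul {x : AlgTensor E F} {s : ℝ} (c : ℂ) (hs : s ∈ x.costs) :
    ‖c‖ * s ∈ (c • x).costs := by
  obtain ⟨n, a, b, rfl, rfl⟩ := hs
  refine ⟨n, fun i => c • a i, b, ?_, ?_⟩
  · rw [Finset.smul_sum]
    rfl
  · simp only [norm_smul, Finset.mul_sum, mul_assoc]

theorem costs_nonempty (x : AlgTensor E F) : x.costs.Nonempty := by
  refine TensorProduct.induction_on (motive := fun x : AlgTensor E F => x.costs.Nonempty) x ?_ ?_ ?_
  · exact ⟨0, 0, Fin.elim0, Fin.elim0, by simp; rfl, by simp⟩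
  · exact fun a b => ⟨‖a‖ * ‖b‖, 1, fun _ => a, fun _ => b, by simp; rfl, by simp⟩
  · rintro x y ⟨s, hs⟩ ⟨t, ht⟩
    exact ⟨s + t, costs_add hs ht⟩

theorem norm_smul_le' (c : ℂ) (x : AlgTensor E F) : ‖c • x‖ ≤ ‖c‖ * ‖x‖ := by
  rw [norm_def x, ← smul_eq_mul, ← Real.sInf_smul_of_nonneg (norm_nonneg c)]
  refine le_csInf (x.costs_nonempty.image _) ?_
  rintro _ ⟨s, hs, rfl⟩
  exact csInf_le (costs_bddBelow _) (costs_smul c hs)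

theorem core : SeminormedSpace.Core ℂ (AlgTensor E F) where
  norm_nonneg x := Real.sInf_nonneg fun _ => costs_nonneg
  norm_smul c x := by
    refine le_antisymm (norm_smul_le' c x) ?_
    rcases eq_or_ne c 0 with rfl | hc
    · rw [norm_zero, zero_mul]
      exact Real.sInf_nonneg fun _ => costs_nonneg
    · have := norm_smul_le' c⁻¹ (c • x)
      rw [inv_smul_smul₀ hc, norm_inv] at this
      have hc' : 0 < ‖c‖ := norm_pos_iff.2 hc
      calc ‖c‖ * ‖x‖ ≤ ‖c‖ * (‖c‖⁻¹ * ‖c • x‖) := by gcongr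
        _ = ‖c • x‖ := by field_simp
  norm_triangle x y := by
    refine le_of_forall_pos_lt_add fun ε hε => ?_
    obtain ⟨s, hs, hs'⟩ := Real.lt_sInf_add_pos x.costs_nonempty (half_pos hε)
    obtain ⟨t, ht, ht'⟩ := Real.lt_sInf_add_pos y.costs_nonempty (half_pos hε)
    have : ‖x + y‖ ≤ s + t := csInf_le (costs_bddBelow _) (costs_add hs ht)
    rw [norm_def x, norm_def y]
    linarith

instance : SeminormedAddCommGroup (AlgTensor E F) := SeminormedAddCommGroup.ofCore core

instance : NormedSpace ℂ (AlgTensor E F) where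
  norm_smul_le := norm_smul_le'

/-- The functional `a ⊗ b ↦ β(a, b)` on `E ⊙ F`, as a linear map. -/
def liftLin (β : E →L[ℂ] F →L[ℂ] ℂ) : AlgTensor E F →ₗ[ℂ] ℂ :=
  (TensorProduct.lift β.toLinearMap₁₂ : E ⊗[ℂ] F →ₗ[ℂ] ℂ)

theorem liftLin_tmul (β : E →L[ℂ] F →L[ℂ] ℂ) (a : E) (b : F) :
    liftLin β (tmul a b) = β a b := rfl

theorem norm_liftLin_le (β : E →L[ℂ] F →L[ℂ] ℂ) (x : AlgTensor E F) :
    ‖liftLin β x‖ ≤ ‖β‖ * ‖x‖ := by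
  rw [norm_def, ← smul_eq_mul, ← Real.sInf_smul_of_nonneg (norm_nonneg β)]
  refine le_csInf ((costs_nonempty x).image _) ?_
  rintro _ ⟨s, ⟨n, a, b, rfl, rfl⟩, rfl⟩
  rw [map_sum]
  simp only [smul_eq_mul, Finset.mul_sum]
  refine (norm_sum_le _ _).trans (Finset.sum_le_sum fun i _ => ?_)
  rw [← mul_assoc, liftLin_tmul]
  exact β.le_opNorm₂ (a i) (b i)

/-- The bounded functional `a ⊗ b ↦ β(a, b)` on `E ⊙ F`. -/
def lift (β : E →L[ℂ] F →L[ℂ] ℂ) : AlgTensor E F →L[ℂ] ℂ :=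
  (liftLin β).mkContinuous ‖β‖ (norm_liftLin_le β)

theorem lift_tmul (β : E →L[ℂ] F →L[ℂ] ℂ) (a : E) (b : F) : lift β (tmul a b) = β a b := rfl

end AlgTensor

/-- The projective tensor product `E ⊗̂ F`. -/
abbrev ProjTensor : Type _ := UniformSpace.Completion (AlgTensor E F)

namespace ProjTensor

variable {E F}

/-- The elementary tensor `a ⊗ b` in `E ⊗̂ F`. -/
def tmul (a : E) (b : F) : ProjTensor E F := (AlgTensor.tmul a b : AlgTensor E F)

/-- The bounded functional on `E ⊗̂ F` with `a ⊗ b ↦ β(a, b)`. -/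
def lift (β : E →L[ℂ] F →L[ℂ] ℂ) : StrongDual ℂ (ProjTensor E F) :=
  (AlgTensor.lift β).extend UniformSpace.Completion.toComplL

theorem lift_tmul (β : E →L[ℂ] F →L[ℂ] ℂ) (a : E) (b : F) : lift β (tmul a b) = β a b := by
  refine (ContinuousLinearMap.extend_eq (AlgTensor.lift β)
    (UniformSpace.Completion.denseRange_coe) ?_ (AlgTensor.tmul a b)).trans
      (AlgTensor.lift_tmul β a b)
  exact UniformSpace.Completion.isUniformInducing_coe _

end ProjTensor

end Projective

/-! ### Functionals -/

section Functionals

open scoped ComplexOrder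

/-- A state of a unital `*`-algebra `M` of operators: a positive functional with value `1` at `1`. -/
structure IsState {M : Type*} [NormedRing M] [NormedAlgebra ℂ M] [StarRing M]
    (σ : M →L[ℂ] ℂ) : Prop where
  nonneg : ∀ a, 0 ≤ σ (star a * a)
  map_one : σ 1 = 1

variable {H : Type*} [NormedAddCommGroup H] [InnerProductSpace ℂ H] [CompleteSpace H]

/-- A normal state of `B(H)`: a state that is weakly continuous on bounded sets. -/
structure IsNormalState (ω : (H →L[ℂ] H) →L[ℂ] ℂ) : Prop extends IsState ω where
  weaklyContinuous : ∀ r : ℝ,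
    ContinuousOn (fun T : H →WOT[ℂ] H => ω T.toCLM) {T | ‖T.toCLM‖ ≤ r}

variable {ι : Type*} {M : Type*} [NormedRing M] [NormedAlgebra ℂ M]

/-- The functional `a ⊗ b ↦ σ(a) ω(b)` on `M ⊗̂ T(H)`. -/
def prodFunctional (σ : M →L[ℂ] ℂ) (ω : (H →L[ℂ] H) →L[ℂ] ℂ) :
    StrongDual ℂ (ProjTensor M (TraceClass H)) :=
  ProjTensor.lift (σ.smulRight (ω.comp TraceClass.toCLML))

theorem prodFunctional_tmul (σ : M →L[ℂ] ℂ) (ω : (H →L[ℂ] H) →L[ℂ] ℂ) (a : M)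
    (b : TraceClass H) : prodFunctional σ ω (ProjTensor.tmul a b) = σ a * ω b.toCLM := by
  rw [prodFunctional, ProjTensor.lift_tmul]
  rfl

theorem IsTraceClass.trace_add {b c : H →L[ℂ] H} (hb : IsTraceClass b) (hc : IsTraceClass c)
    (e : HilbertBasis ι ℂ H) : trace e (b + c) = trace e b + trace e c := by
  obtain ⟨x, y, hb⟩ := hb
  obtain ⟨x', y', hc⟩ := hc
  rw [trace, trace, trace, ← (hb.trace_spec e).1.tsum_add (hc.trace_spec e).1]
  exact tsum_congr fun i => by simp

theorem trace_smul (e : HilbertBasis ι ℂ H) (c : ℂ) (b : H →L[ℂ] H) :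
    trace e (c • b) = c * trace e b := by
  rw [trace, trace, ← tsum_mul_left]
  exact tsum_congr fun i => by simp

theorem isTraceClass_comp_transpose (e : HilbertBasis ι ℂ H) (a : H →L[ℂ] H)
    (b : TraceClass H) : IsTraceClass (a ∘L transpose e b.toCLM) := by
  obtain ⟨x, y, h⟩ := b.isTraceClass
  exact ⟨_, _, (h.transpose e).comp_left a⟩

theorem norm_trace_comp_le (e : HilbertBasis ι ℂ H) (a : H →L[ℂ] H) {c : H →L[ℂ] H}
    {x y : ℕ → H} (h : IsTraceRep c x y) : ‖trace e (a ∘L c)‖ ≤ ‖a‖ * repCost x y := by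
  have h' := h.comp_left a
  refine (h'.norm_trace_le e).trans ?_
  rw [repCost, repCost, ← tsum_mul_left]
  refine h'.summable.tsum_le_tsum (fun n => ?_) (h.summable.mul_left _)
  calc ‖x n‖ * ‖a (y n)‖ ≤ ‖x n‖ * (‖a‖ * ‖y n‖) := by gcongr; exact a.le_opNorm _
    _ = _ := by ring

/-- The bounded bilinear form `(a, b) ↦ Tr(φ(a) bᵗ)` on `M × T(H)`. -/
def tildeForm (e : HilbertBasis ι ℂ H) (φ : M →L[ℂ] (H →L[ℂ] H)) :
    M →L[ℂ] TraceClass H →L[ℂ] ℂ :=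
  LinearMap.mkContinuous₂
    (LinearMap.mk₂ ℂ (fun a b => trace e (φ a ∘L transpose e b.toCLM))
      (fun a a' b => by
        rw [map_add, ContinuousLinearMap.add_comp]
        exact (isTraceClass_comp_transpose e _ b).trace_add (isTraceClass_comp_transpose e _ b) e)
      (fun c a b => by rw [map_smul, ContinuousLinearMap.smul_comp, trace_smul, smul_eq_mul])
      (fun a b b' => by
        rw [map_add, transpose_add, ContinuousLinearMap.comp_add]
        exact (isTraceClass_comp_transpose e _ b).trace_add (isTraceClass_comp_transpose e _ b') e)
      (fun c a b => by
        rw [map_smul, transpose_smul, ContinuousLinearMap.comp_smul, trace_smul, smul_eq_mul]))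
    ‖φ‖ fun a b => by
      refine TraceClass.le_mul_norm (by positivity) fun x y h => ?_
      rw [← repCost_transpose e]
      refine (norm_trace_comp_le e (φ a) (h.transpose e)).trans ?_
      gcongr
      · exact repCost_nonneg _ _
      · exact φ.le_opNorm a

/-- The functional `φ̃` on `M ⊗̂ T(H)` with `φ̃(a ⊗ b) = Tr(φ(a) bᵗ)`. -/
def tilde (e : HilbertBasis ι ℂ H) (φ : M →L[ℂ] (H →L[ℂ] H)) :
    StrongDual ℂ (ProjTensor M (TraceClass H)) :=
  ProjTensor.lift (tildeForm e φ)

theorem tilde_tmul (e : HilbertBasis ι ℂ H) (φ : M →L[ℂ] (H →L[ℂ] H)) (a : M)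
    (b : TraceClass H) :
    tilde e φ (ProjTensor.tmul a b) = trace e (φ a ∘L transpose e b.toCLM) := by
  rw [tilde, ProjTensor.lift_tmul]
  rfl

variable [StarRing M]

variable (H M) in
/-- The positive sums of functionals `σ ⊗ ω`, with `σ` a state of `M` and `ω` a normal state
of `B(H)`. -/
def productCone : Set (StrongDual ℂ (ProjTensor M (TraceClass H))) :=
  {ρ | ∃ (n : ℕ) (c : Fin n → ℝ) (σ : Fin n → (M →L[ℂ] ℂ))
      (ω : Fin n → ((H →L[ℂ] H) →L[ℂ] ℂ)),
    (∀ i, 0 ≤ c i ∧ IsState (σ i) ∧ IsNormalState (ω i)) ∧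
      ρ = ∑ i, (c i : ℂ) • prodFunctional (σ i) (ω i)}

/-- The functional `ρ` on `M ⊗̂ T(H)` is separable: it belongs to the weak-star closed convex cone
of `(M ⊗̂ T(H))*` generated by the functionals `σ ⊗ ω`. By the bipolar theorem, this cone is the
double dual cone of the set of these functionals. (Such a `ρ` is automatically positive.) -/
def IsSeparable (ρ : StrongDual ℂ (ProjTensor M (TraceClass H))) : Prop :=
  StrongDual.toWeakDual ρ ∈ closure (StrongDual.toWeakDual '' productCone H M)

/-- The functional `ρ` on `M ⊗̂ T(H)` belongs to the norm closed convex cone of `(M ⊗̂ T(H))*`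
generated by the functionals `σ ⊗ ω`. -/
def IsNormSeparable (ρ : StrongDual ℂ (ProjTensor M (TraceClass H))) : Prop :=
  ρ ∈ closure (productCone H M)

/-- A unital `*`-subalgebra of `B(H)` that is norm closed, i.e. a C*-algebra on `H` that contains
the identity operator. -/
def IsCStarSubalgebra (A : StarSubalgebra ℂ (H →L[ℂ] H)) : Prop :=
  IsClosed (A : Set (H →L[ℂ] H))

/-- `φ`, regarded as a map into `B(H)`, is a conditional expectation of `B` onto `A`: a positive
`A`-bimodule projection of `B` onto `A`. -/
structure IsConditionalExpectation (A B : StarSubalgebra ℂ (H →L[ℂ] H))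
    (φ : B →L[ℂ] (H →L[ℂ] H)) : Prop where
  map_mem : ∀ b, φ b ∈ A
  map_of_mem : ∀ b : B, (b : H →L[ℂ] H) ∈ A → φ b = b
  nonneg : ∀ b : B, 0 ≤ φ (star b * b)
  map_mul_mul : ∀ a b c : B, (a : H →L[ℂ] H) ∈ A → (c : H →L[ℂ] H) ∈ A →
    φ (a * b * c) = a * φ b * c

end Functionals

end SepMap

end

/-! If `A` is abelian, Gelfand duality identifies it with continuous functions on its character
space. A partition of unity fine enough for finitely many given elements approximates each of them,
in norm, by a sum `∑ χₖ(a) gₖ* gₖ` with characters `χₖ` (`exists_characters_norm_sub_le`). Composing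
with `φ` gives maps `∑ (χₖ ∘ φ) gₖ* gₖ`, bounded in norm by `‖φ‖` and converging to `φ` pointwise,
and each `χₖ ∘ φ` is a state. A single term `σ(·) g* g` is separable because `Tr(g* g bᵗ)` is a sum
of vector functionals of `b` (`hasSum_vectorFunctional`). Bounded pointwise convergence of maps
gives weak-star convergence of the functionals (`tendsto_tilde`), so `φ̃` is separable.

Conversely, Cauchy–Schwarz for states makes every `σ ⊗ ω`, hence every separable functional,
nonnegative on partial transposes of squares (`IsSeparable.partialTranspose_nonneg`). On `φ̃`, which
restricts to the identity on `A`, this test yields `‖x* v‖ ≤ ‖x v‖` for all `x ∈ A` and all `v`.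
Applied also to `x*`, it makes every element of `A` normal, and polarization makes `A` abelian.

In finite dimension the weak-star and norm topologies on the dual agree. -/

open Filter Topology

noncomputable section

namespace SepMap

/-! ### Functionals on the projective tensor product -/

section Dual

variable {E F : Type*} [SeminormedAddCommGroup E] [NormedSpace ℂ E]
  [SeminormedAddCommGroup F] [NormedSpace ℂ F]

/-- Additive properties of elements of `E ⊙ F` may be checked on elementary tensors. -/
theorem AlgTensor.induction {p : AlgTensor E F → Prop} (hadd : ∀ x y, p x → p y → p (x + y))
    (h : ∀ a b, p (tmul a b)) (z : AlgTensor E F) : p z :=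
  TensorProduct.induction_on (motive := fun z : AlgTensor E F => p z) z
    (by have := h 0 0; rwa [show tmul (0 : E) (0 : F) = 0 from TensorProduct.zero_tmul _ _] at this)
    h hadd

/-- Closed additive properties of elements of `E ⊗̂ F` may be checked on elementary tensors. -/
theorem ProjTensor.induction {p : ProjTensor E F → Prop} (hc : IsClosed {z | p z})
    (hadd : ∀ x y, p x → p y → p (x + y)) (h : ∀ a b, p (tmul a b)) (z : ProjTensor E F) : p z := by
  refine UniformSpace.Completion.induction_on z hc fun x => ?_
  refine AlgTensor.induction (p := fun x => p (x : ProjTensor E F)) (fun x y hx hy => ?_) h x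
  rw [UniformSpace.Completion.coe_add]
  exact hadd _ _ hx hy

theorem ProjTensor.dual_ext {ρ ρ' : StrongDual ℂ (ProjTensor E F)}
    (h : ∀ a b, ρ (tmul a b) = ρ' (tmul a b)) : ρ = ρ' := by
  ext z
  refine ProjTensor.induction (p := fun z => ρ z = ρ' z)
    (isClosed_eq ρ.continuous ρ'.continuous) (fun x y hx hy => ?_) h z
  rw [map_add, map_add, hx, hy]

theorem ProjTensor.norm_lift_le (β : E →L[ℂ] F →L[ℂ] ℂ) : ‖lift β‖ ≤ ‖β‖ := by
  refine ContinuousLinearMap.opNorm_le_bound _ (norm_nonneg β) fun z => ?_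
  refine UniformSpace.Completion.induction_on z
    (isClosed_le (by fun_prop) (by fun_prop)) fun x => ?_
  have : lift β (x : ProjTensor E F) = AlgTensor.lift β x :=
    ContinuousLinearMap.extend_eq (AlgTensor.lift β) UniformSpace.Completion.denseRange_coe
      (UniformSpace.Completion.isUniformInducing_coe _) x
  rw [this, UniformSpace.Completion.norm_coe]
  exact AlgTensor.norm_liftLin_le β x

/-- The uniform bound makes the functionals equicontinuous, so the set of points where they converge
to the limit is closed. Being also additive, convergence need only be tested on elementary tensors.
-/
theorem ProjTensor.tendsto_lift {κ : Type*} {l : Filter κ} {β : κ → E →L[ℂ] F →L[ℂ] ℂ}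
    {β' : E →L[ℂ] F →L[ℂ] ℂ} {C : ℝ} (hC : ∀ k, ‖β k‖ ≤ C)
    (h : ∀ a b, Tendsto (fun k => β k a b) l (𝓝 (β' a b))) :
    Tendsto (fun k => StrongDual.toWeakDual (lift (β k))) l
      (𝓝 (StrongDual.toWeakDual (lift β'))) := by
  rw [tendsto_iff_forall_eval_tendsto_topDualPairing]
  have hC' : ∃ C, ∀ k, ‖lift (β k)‖ ≤ C := ⟨C, fun k => (norm_lift_le _).trans (hC k)⟩
  have heq : Equicontinuous (DFunLike.coe ∘ fun k => lift (β k)) :=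
    ((NormedSpace.equicontinuous_TFAE fun k => lift (β k)).out 1 5 rfl rfl).2 hC'
  refine ProjTensor.induction (heq.isClosed_setOfPred_tendsto (lift β').continuous)
    (fun x y hx hy => ?_) fun a b => ?_
  · simpa only [Function.comp_apply, map_add] using hx.add hy
  · change Tendsto (fun k => lift (β k) (tmul a b)) l (𝓝 (lift β' (tmul a b)))
    simpa only [lift_tmul] using h a b

end Dual

/-! ### Vector functionals, continuity of `φ ↦ φ̃`, and the product cone -/

section Functionals

open scoped ComplexOrder

variable {H ι : Type*} [NormedAddCommGroup H] [InnerProductSpace ℂ H] [CompleteSpace H]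
  {M : Type*} [NormedRing M] [NormedAlgebra ℂ M]

/-- The functional `T ↦ ⟨w, T w⟩` on `B(H)`. -/
def vectorFunctional (w : H) : (H →L[ℂ] H) →L[ℂ] ℂ :=
  (innerSL ℂ w).comp (ContinuousLinearMap.apply ℂ H w)

omit [CompleteSpace H] in
theorem vectorFunctional_apply (w : H) (T : H →L[ℂ] H) :
    vectorFunctional w T = ⟪w, T w⟫_ℂ := rfl

theorem isNormalState_vectorFunctional {w : H} (hw : ‖w‖ = 1) :
    IsNormalState (vectorFunctional w) where
  nonneg a := by
    rw [vectorFunctional_apply, mul_apply_eq_comp, ContinuousLinearMap.star_eq_adjoint,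
      ContinuousLinearMap.adjoint_inner_right]
    rw [inner_self_eq_norm_sq_to_K]
    exact Complex.zero_le_real.2 (sq_nonneg ‖a w‖) |>.trans_eq (by push_cast; rfl)
  map_one := by
    rw [vectorFunctional_apply, one_apply_eq_self, inner_self_eq_norm_sq_to_K, hw]
    simp
  weaklyContinuous r := by
    refine Continuous.continuousOn ?_
    exact ContinuousLinearMapWOT.continuous_dual_apply w (innerSL ℂ w)

omit [CompleteSpace H] in
theorem vectorFunctional_smul (c : ℝ) (w : H) (T : H →L[ℂ] H) :
    vectorFunctional ((c : ℂ) • w) T = ((c ^ 2 : ℝ) : ℂ) * vectorFunctional w T := by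
  simp only [vectorFunctional_apply, map_smul, inner_smul_left, inner_smul_right]
  simp
  ring

theorem tilde_add (e : HilbertBasis ι ℂ H) (φ ψ : M →L[ℂ] (H →L[ℂ] H)) :
    tilde e (φ + ψ) = tilde e φ + tilde e ψ := by
  refine ProjTensor.dual_ext fun a b => ?_
  rw [add_apply, tilde_tmul, tilde_tmul, tilde_tmul,
    add_apply, ContinuousLinearMap.add_comp]
  exact (isTraceClass_comp_transpose e _ b).trace_add (isTraceClass_comp_transpose e _ b) e

theorem tilde_zero (e : HilbertBasis ι ℂ H) : tilde e (0 : M →L[ℂ] (H →L[ℂ] H)) = 0 := by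
  simpa using tilde_add e (0 : M →L[ℂ] (H →L[ℂ] H)) 0

theorem norm_trace_comp_transpose_le (e : HilbertBasis ι ℂ H) (a : H →L[ℂ] H) (b : TraceClass H) :
    ‖trace e (a ∘L transpose e b.toCLM)‖ ≤ ‖a‖ * ‖b‖ := by
  refine TraceClass.le_mul_norm (norm_nonneg a) fun x y h => ?_
  rw [← repCost_transpose e]
  exact norm_trace_comp_le e a (h.transpose e)

theorem norm_tildeForm_le (e : HilbertBasis ι ℂ H) (φ : M →L[ℂ] (H →L[ℂ] H)) :
    ‖tildeForm e φ‖ ≤ ‖φ‖ :=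
  LinearMap.mkContinuous₂_norm_le _ (norm_nonneg φ) _

theorem tildeForm_apply (e : HilbertBasis ι ℂ H) (φ : M →L[ℂ] (H →L[ℂ] H)) (a : M)
    (b : TraceClass H) : tildeForm e φ a b = trace e (φ a ∘L transpose e b.toCLM) := rfl

/-- `φ ↦ φ̃` is continuous from the point-norm topology to the weak-star topology, on bounded
sets. -/
theorem tendsto_tilde (e : HilbertBasis ι ℂ H) {κ : Type*} {l : Filter κ}
    {ψ : κ → M →L[ℂ] (H →L[ℂ] H)} {φ : M →L[ℂ] (H →L[ℂ] H)} {C : ℝ} (hC : ∀ k, ‖ψ k‖ ≤ C)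
    (h : ∀ a, Tendsto (fun k => ψ k a) l (𝓝 (φ a))) :
    Tendsto (fun k => StrongDual.toWeakDual (tilde e (ψ k))) l
      (𝓝 (StrongDual.toWeakDual (tilde e φ))) := by
  refine ProjTensor.tendsto_lift (fun k => (norm_tildeForm_le e (ψ k)).trans (hC k)) fun a b => ?_
  simp only [tildeForm_apply]
  rw [tendsto_iff_norm_sub_tendsto_zero]
  have h0 : Tendsto (fun k => ‖ψ k a - φ a‖ * ‖b‖) l (𝓝 0) := by
    simpa using (tendsto_iff_norm_sub_tendsto_zero.1 (h a)).mul_const ‖b‖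
  refine squeeze_zero (fun _ => norm_nonneg _) (fun k => ?_) h0
  refine le_trans (le_of_eq ?_) (norm_trace_comp_transpose_le e (ψ k a - φ a) b)
  have := (isTraceClass_comp_transpose e (ψ k a - φ a) b).trace_add
    (isTraceClass_comp_transpose e (φ a) b) e
  rw [← ContinuousLinearMap.add_comp, sub_add_cancel] at this
  rw [this, add_sub_cancel_right]

theorem IsTraceRep.comp_right {b : H →L[ℂ] H} {x y : ℕ → H} (h : IsTraceRep b x y)
    (a : H →L[ℂ] H) : IsTraceRep (b ∘L a) (fun n => a.adjoint (x n)) y := by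
  refine ⟨?_, fun v => ?_⟩
  · refine Summable.of_nonneg_of_le (fun n => by positivity) (fun n => ?_)
      (h.summable.mul_left ‖a.adjoint‖)
    calc ‖a.adjoint (x n)‖ * ‖y n‖ ≤ (‖a.adjoint‖ * ‖x n‖) * ‖y n‖ := by
          gcongr; exact a.adjoint.le_opNorm _
      _ = _ := by ring
  · simpa [ContinuousLinearMap.adjoint_inner_left] using h.hasSum (a v)

theorem inner_transpose_apply (e : HilbertBasis ι ℂ H) (b : H →L[ℂ] H) (u v : H) :
    ⟪u, transpose e b v⟫_ℂ = ⟪conj e v, b (conj e u)⟫_ℂ := by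
  conv_lhs => rw [← conj_conj e u]
  simp only [transpose, ContinuousLinearMap.comp_apply]
  rw [inner_conj_conj, ContinuousLinearMap.adjoint_inner_left]

/-- `Tr(g* g bᵗ) = ∑ₖ ⟨wₖ, b wₖ⟩`, where `wₖ` is the conjugate of `g* eₖ`. -/
theorem hasSum_vectorFunctional (e : HilbertBasis ι ℂ H) (g : H →L[ℂ] H) (b : TraceClass H) :
    HasSum (fun k => vectorFunctional (conj e (g.adjoint (e k))) b.toCLM)
      (trace e ((star g * g) ∘L transpose e b.toCLM)) := by
  obtain ⟨x, y, h⟩ := b.isTraceClass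
  have h1 := (h.transpose e).comp_left (star g * g)
  have h2 := ((h.transpose e).comp_left g).comp_right g.adjoint
  have h3 := h2.trace_spec e
  -- Cyclicity of the trace: in the nuclear expansion both sides equal `∑ₙ ⟨g ȳₙ, g x̄ₙ⟩`, the bar
  -- being `conj e`.
  have h4 : trace e ((star g * g) ∘L transpose e b.toCLM) =
      trace e ((g ∘L transpose e b.toCLM) ∘L g.adjoint) := by
    rw [h3.2, (h1.trace_spec e).2]
    refine tsum_congr fun n => ?_
    simp [ContinuousLinearMap.star_eq_adjoint, ContinuousLinearMap.adjoint_inner_right]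
  rw [h4]
  rw [trace]
  convert h3.1.hasSum using 2 with k
  rw [vectorFunctional_apply, ← inner_transpose_apply]
  simp [ContinuousLinearMap.adjoint_inner_left]

/-- The bound is independent of `S`, as equicontinuity of the partial sums requires. Each rank-one
term of `b` reduces it to Cauchy–Schwarz for the coefficients of `g ȳₙ` and `g x̄ₙ` in the basis. -/
theorem norm_sum_vectorFunctional_le (e : HilbertBasis ι ℂ H) (g : H →L[ℂ] H) (S : Finset ι)
    (b : TraceClass H) :
    ‖∑ k ∈ S, vectorFunctional (conj e (g.adjoint (e k))) b.toCLM‖ ≤ ‖g‖ ^ 2 * ‖b‖ := by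
  refine TraceClass.le_mul_norm (by positivity) fun x y h => ?_
  have hk : ∀ k ∈ S, HasSum (fun n => ⟪x n, conj e (g.adjoint (e k))⟫_ℂ *
      ⟪conj e (g.adjoint (e k)), y n⟫_ℂ)
      (vectorFunctional (conj e (g.adjoint (e k))) b.toCLM) := fun k _ => by
    simpa [inner_smul_right, vectorFunctional_apply] using
      (innerSL ℂ (conj e (g.adjoint (e k)))).hasSum (h.hasSum (conj e (g.adjoint (e k))))
  rw [← (hasSum_sum hk).tsum_eq]
  have hs := h.summable.mul_left (‖g‖ ^ 2)
  rw [repCost, ← tsum_mul_left]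
  refine tsum_of_norm_bounded hs.hasSum fun n => ?_
  have hx : ∀ k v, ⟪conj e (g.adjoint (e k)), v⟫_ℂ = ⟪g (conj e v), e k⟫_ℂ := fun k v => by
    conv_lhs => rw [← conj_conj e v]
    rw [inner_conj_conj, ContinuousLinearMap.adjoint_inner_right]
  have hx' : ∀ k v, ⟪v, conj e (g.adjoint (e k))⟫_ℂ = ⟪e k, g (conj e v)⟫_ℂ := fun k v => by
    rw [← inner_conj_symm, hx, inner_conj_symm]
  obtain ⟨h1, h2⟩ := summable_inner_mul_inner_norm e (g (conj e (y n))) (g (conj e (x n)))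
  calc ‖∑ k ∈ S, ⟪x n, conj e (g.adjoint (e k))⟫_ℂ * ⟪conj e (g.adjoint (e k)), y n⟫_ℂ‖
      ≤ ∑ k ∈ S, ‖⟪g (conj e (y n)), e k⟫_ℂ * ⟪e k, g (conj e (x n))⟫_ℂ‖ := by
        refine (norm_sum_le _ _).trans (Finset.sum_le_sum fun k _ => ?_)
        rw [hx, hx', mul_comm]
    _ ≤ ‖g (conj e (y n))‖ * ‖g (conj e (x n))‖ :=
        (h1.sum_le_tsum _ fun _ _ => norm_nonneg _).trans h2
    _ ≤ (‖g‖ * ‖y n‖) * (‖g‖ * ‖x n‖) := by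
        rw [← norm_conj e (y n), ← norm_conj e (x n)]
        gcongr <;> exact g.le_opNorm _
    _ = ‖g‖ ^ 2 * (‖x n‖ * ‖y n‖) := by ring

variable [StarRing M]

theorem zero_mem_productCone : (0 : StrongDual ℂ (ProjTensor M (TraceClass H))) ∈
    productCone H M :=
  ⟨0, Fin.elim0, Fin.elim0, Fin.elim0, fun i => i.elim0, by simp⟩

theorem add_mem_productCone {ρ ρ' : StrongDual ℂ (ProjTensor M (TraceClass H))}
    (h : ρ ∈ productCone H M) (h' : ρ' ∈ productCone H M) : ρ + ρ' ∈ productCone H M := by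
  obtain ⟨n, c, σ, ω, h, rfl⟩ := h
  obtain ⟨n', c', σ', ω', h', rfl⟩ := h'
  refine ⟨n + n', Fin.append c c', Fin.append σ σ', Fin.append ω ω', fun i => ?_,
    by simp [Fin.sum_univ_add]⟩
  refine Fin.addCases (fun i => ?_) (fun i => ?_) i
  · simpa using h i
  · simpa using h' i

theorem prodFunctional_vectorFunctional_mem {σ : M →L[ℂ] ℂ} (hσ : IsState σ) (w : H) :
    prodFunctional σ (vectorFunctional w) ∈ productCone H M := by
  rcases eq_or_ne w 0 with rfl | hw
  · convert zero_mem_productCone (H := H) (M := M)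
    refine ProjTensor.dual_ext fun a b => ?_
    simp [prodFunctional_tmul, vectorFunctional_apply]
  · have hw' : ‖w‖ ≠ 0 := norm_ne_zero_iff.2 hw
    -- Normalizing `w` produces a state; the functional is quadratic in `w`, hence the weight `‖w‖ ^
    -- 2`.
    refine ⟨1, fun _ => ‖w‖ ^ 2, fun _ => σ,
      fun _ => vectorFunctional (((‖w‖⁻¹ : ℝ) : ℂ) • w), fun _ => ⟨by positivity, hσ, ?_⟩, ?_⟩
    · exact isNormalState_vectorFunctional (by simp [norm_smul, hw'])
    · refine ProjTensor.dual_ext fun a b => ?_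
      have h1 : ((‖w‖ : ℂ)) ≠ 0 := by exact_mod_cast hw'
      simp only [Finset.univ_unique, Finset.sum_singleton, smul_apply,
        prodFunctional_tmul, vectorFunctional_smul, smul_eq_mul]
      push_cast
      field_simp

theorem isSeparable_zero : IsSeparable (0 : StrongDual ℂ (ProjTensor M (TraceClass H))) :=
  subset_closure ⟨0, zero_mem_productCone, rfl⟩

theorem IsSeparable.add {ρ ρ' : StrongDual ℂ (ProjTensor M (TraceClass H))}
    (h : IsSeparable ρ) (h' : IsSeparable ρ') : IsSeparable (ρ + ρ') := by
  unfold IsSeparable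
  rw [map_add]
  refine map_mem_closure₂ continuous_add h h' ?_
  rintro _ ⟨ρ, h, rfl⟩ _ ⟨ρ', h', rfl⟩
  exact ⟨_, add_mem_productCone h h', map_add _ _ _⟩

/-- The maps `a ↦ σ(a) g* g` with a state `σ` are separable. -/
theorem isSeparable_tilde_smulRight (e : HilbertBasis ι ℂ H) {σ : M →L[ℂ] ℂ} (hσ : IsState σ)
    (g : H →L[ℂ] H) : IsSeparable (tilde e (σ.smulRight (star g * g))) := by
  set ω : Finset ι → (TraceClass H →L[ℂ] ℂ) := fun S =>
    (∑ k ∈ S, vectorFunctional (conj e (g.adjoint (e k)))).comp TraceClass.toCLML with hω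
  have hωb : ∀ S b, ω S b = ∑ k ∈ S, vectorFunctional (conj e (g.adjoint (e k))) b.toCLM :=
    fun S b => by
      simp only [hω, ContinuousLinearMap.comp_apply, sum_apply]; rfl
  have hωn : ∀ S, ‖ω S‖ ≤ ‖g‖ ^ 2 := fun S =>
    ContinuousLinearMap.opNorm_le_bound _ (by positivity) fun b => by
      rw [hωb]; exact norm_sum_vectorFunctional_le e g S b
  have hlim : Tendsto (fun S => StrongDual.toWeakDual (ProjTensor.lift (σ.smulRight (ω S)))) atTop
      (𝓝 (StrongDual.toWeakDual (tilde e (σ.smulRight (star g * g))))) := by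
    refine ProjTensor.tendsto_lift (C := ‖σ‖ * ‖g‖ ^ 2) (fun S => ?_) fun a b => ?_
    · rw [ContinuousLinearMap.norm_smulRight_apply]
      gcongr
      exact hωn S
    · simp only [ContinuousLinearMap.smulRight_apply, tildeForm_apply,
        ContinuousLinearMap.smul_comp, trace_smul, smul_apply, smul_eq_mul, hωb]
      exact Tendsto.const_mul _ (hasSum_vectorFunctional e g b)
  refine mem_closure_of_tendsto hlim (Eventually.of_forall fun S => ⟨_, ?_, rfl⟩)
  classical
  induction S using Finset.induction_on with
  | empty =>
    convert zero_mem_productCone (H := H) (M := M)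
    refine ProjTensor.dual_ext fun a b => ?_
    simp [ProjTensor.lift_tmul, hωb]
  | insert k S hk ih =>
    convert add_mem_productCone
      (prodFunctional_vectorFunctional_mem hσ (conj e (g.adjoint (e k)))) ih
    refine ProjTensor.dual_ext fun a b => ?_
    simp [ProjTensor.lift_tmul, hωb, prodFunctional_tmul, Finset.sum_insert hk, mul_add]

end Functionals

/-! ### Approximation of the identity by characters -/

/-- The identity map of a commutative C*-algebra is a point-norm limit of contractions of the form
`a ↦ ∑ₖ χₖ(a) gₖ* gₖ` with characters `χₖ`. -/
theorem exists_characters_norm_sub_le {A : Type*} [CommCStarAlgebra A] (s : Finset A) {ε : ℝ}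
    (hε : 0 < ε) :
    ∃ (K : Finset (WeakDual.characterSpace ℂ A)) (g : WeakDual.characterSpace ℂ A → A),
      (∀ a ∈ s, ‖∑ x ∈ K, x a • (star (g x) * g x) - a‖ ≤ ε) ∧
        ∀ a, ‖∑ x ∈ K, x a • (star (g x) * g x)‖ ≤ ‖a‖ := by
  classical
  let X := WeakDual.characterSpace ℂ A
  let Γ := gelfandStarTransform A
  have hΓ : ∀ a, ‖Γ a‖ = ‖a‖ := fun a =>
    (gelfandTransform_isometry A).norm_map_of_map_zero (map_zero _) a
  have hΓx : ∀ a (x : X), Γ a x = x a := fun _ _ => rfl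
  -- The partition of unity is indexed by the characters themselves, so each bump function carries
  -- its own evaluation point.
  let U : X → Set X := fun x => ⋂ a ∈ s, {y | ‖Γ a x - Γ a y‖ < ε}
  have hU : ∀ x, IsOpen (U x) := fun x =>
    isOpen_biInter_finset fun a _ => isOpen_lt (by fun_prop) continuous_const
  have hxU : ∀ x, x ∈ U x := fun x => by simp [U, hε]
  obtain ⟨f, hf⟩ := PartitionOfUnity.exists_isSubordinate isClosed_univ U hU
    fun x _ => Set.mem_iUnion.2 ⟨x, hxU x⟩
  have hfin : {x | (Function.support (f x)).Nonempty}.Finite :=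
    f.locallyFinite.finite_nonempty_of_compact
  let K := hfin.toFinset
  have hsum : ∀ y, ∑ x ∈ K, f x y = 1 := fun y => by
    rw [← f.sum_eq_one (Set.mem_univ y)]
    refine (finsum_eq_sum_of_support_subset _ fun x hx => ?_).symm
    exact Finset.mem_coe.2 (hfin.mem_toFinset.2 ⟨y, hx⟩)
  -- Square roots of the bump functions, so that each bump has the form `G* G`.
  let G : X → C(X, ℂ) := fun x =>
    ⟨fun y => ((Real.sqrt (f x y) : ℝ) : ℂ), by fun_prop⟩
  have hG : ∀ x y, star (G x y) * G x y = f x y := fun x y => by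
    change star ((Real.sqrt (f x y) : ℝ) : ℂ) * ((Real.sqrt (f x y) : ℝ) : ℂ) = f x y
    rw [Complex.star_def, Complex.conj_ofReal, ← Complex.ofReal_mul,
      Real.mul_self_sqrt (f.nonneg x y)]
  have hval : ∀ a y, Γ (∑ x ∈ K, x a • (star (Γ.symm (G x)) * Γ.symm (G x))) y =
      ∑ x ∈ K, x a * (f x y : ℂ) := fun a y => by
    simp only [map_sum, map_smul, map_mul, map_star, StarAlgEquiv.apply_symm_apply,
      ContinuousMap.sum_apply, ContinuousMap.smul_apply, ContinuousMap.mul_apply,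
      ContinuousMap.star_apply, hG, smul_eq_mul]
  refine ⟨K, fun x => Γ.symm (G x), fun a ha => ?_, fun a => ?_⟩
  · rw [← hΓ, ContinuousMap.norm_le _ hε.le]
    intro y
    rw [map_sub, ContinuousMap.sub_apply, hval]
    have h1 : Γ a y = ∑ x ∈ K, Γ a y * (f x y : ℂ) := by
      rw [← Finset.mul_sum, ← Complex.ofReal_sum, hsum, Complex.ofReal_one, mul_one]
    rw [h1, ← Finset.sum_sub_distrib]
    calc ‖∑ x ∈ K, (x a * (f x y : ℂ) - Γ a y * (f x y : ℂ))‖ ≤ ∑ x ∈ K, ε * f x y := by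
          refine (norm_sum_le _ _).trans (Finset.sum_le_sum fun x _ => ?_)
          rw [← sub_mul, norm_mul, Complex.norm_real, Real.norm_of_nonneg (f.nonneg x y)]
          by_cases h0 : f x y = 0
          · simp [h0]
          · have hy : y ∈ U x := hf x (subset_tsupport _ h0)
            have := Set.mem_iInter₂.1 hy a ha
            gcongr
            · exact f.nonneg x y
            · exact this.le
      _ = ε := by rw [← Finset.mul_sum, hsum, mul_one]
  · rw [← hΓ, ContinuousMap.norm_le _ (norm_nonneg a)]
    intro y
    rw [hval]
    calc ‖∑ x ∈ K, x a * (f x y : ℂ)‖ ≤ ∑ x ∈ K, ‖a‖ * f x y := by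
          refine (norm_sum_le _ _).trans (Finset.sum_le_sum fun x _ => ?_)
          rw [norm_mul, Complex.norm_real, Real.norm_of_nonneg (f.nonneg x y), ← hΓx, ← hΓ]
          gcongr
          · exact f.nonneg x y
          · exact ContinuousMap.norm_coe_le_norm _ _
      _ = ‖a‖ := by rw [← Finset.mul_sum, hsum, mul_one]

/-! ### Abelian range implies separability -/

section Functionals

open scoped ComplexOrder

variable {H ι : Type*} [NormedAddCommGroup H] [InnerProductSpace ℂ H] [CompleteSpace H]

/-- The character `x` of `A`, composed with the map `φ` into `A`. -/
def characterComp {A B : StarSubalgebra ℂ (H →L[ℂ] H)} {φ : B →L[ℂ] (H →L[ℂ] H)}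
    (hφ : ∀ b, φ b ∈ A) (x : WeakDual.characterSpace ℂ A) : B →L[ℂ] ℂ :=
  (WeakDual.toStrongDual (x : WeakDual ℂ A)).comp
    (⟨{ toFun := fun b => (⟨φ b, hφ b⟩ : A)
        map_add' := fun b c => Subtype.ext (map_add φ b c)
        map_smul' := fun c b => Subtype.ext (map_smul φ c b) },
      φ.continuous.subtype_mk _⟩ : B →L[ℂ] A)

theorem characterComp_apply {A B : StarSubalgebra ℂ (H →L[ℂ] H)} {φ : B →L[ℂ] (H →L[ℂ] H)}
    (hφ : ∀ b, φ b ∈ A) (x : WeakDual.characterSpace ℂ A) (b : B) :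
    characterComp hφ x b = x ⟨φ b, hφ b⟩ := rfl

/-- A character takes values in the spectrum. As `A` is closed, spectra in `A` and in `B(H)`
coincide, so positivity of `φ (b* b)` in `B(H)` suffices. -/
theorem isState_characterComp {A B : StarSubalgebra ℂ (H →L[ℂ] H)} (hA : IsCStarSubalgebra A)
    {φ : B →L[ℂ] (H →L[ℂ] H)} (hφ : IsConditionalExpectation A B φ)
    (x : WeakDual.characterSpace ℂ A) : IsState (characterComp hφ.map_mem x) where
  nonneg b := by
    rw [characterComp_apply]
    have : IsClosed (A : Set (H →L[ℂ] H)) := hA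
    have h1 := AlgHom.apply_mem_spectrum x (⟨φ (star b * b), hφ.map_mem _⟩ : A)
    rw [StarSubalgebra.spectrum_eq] at h1
    exact spectrum_nonneg_of_nonneg (hφ.nonneg b) h1
  map_one := by
    rw [characterComp_apply]
    have h1 : (⟨φ 1, hφ.map_mem 1⟩ : A) = 1 :=
      Subtype.ext (hφ.map_of_mem 1 (one_mem A))
    rw [h1]
    exact map_one x

theorem isSeparable_tilde_of_commute (e : HilbertBasis ι ℂ H)
    {A B : StarSubalgebra ℂ (H →L[ℂ] H)} (hA : IsCStarSubalgebra A)
    {φ : B →L[ℂ] (H →L[ℂ] H)} (hφ : IsConditionalExpectation A B φ)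
    (hcomm : ∀ a ∈ A, ∀ b ∈ A, a * b = b * a) : IsSeparable (tilde e φ) := by
  classical
  let _ : CommCStarAlgebra A :=
    { StarSubalgebra.cstarAlgebra A (h_closed := hA) with
      mul_comm := fun a b => Subtype.ext (hcomm a a.2 b b.2) }
  -- The approximants form a net: the finite set says where to approximate, the integer how well.
  have key : ∀ p : Finset B × ℕ, ∃ ψ : B →L[ℂ] (H →L[ℂ] H), IsSeparable (tilde e ψ) ∧
      (∀ b ∈ p.1, ‖ψ b - φ b‖ ≤ 1 / ((p.2 : ℝ) + 1)) ∧ ‖ψ‖ ≤ ‖φ‖ := fun p => by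
    obtain ⟨K, g, h1, h2⟩ := exists_characters_norm_sub_le
      (p.1.image fun b => (⟨φ b, hφ.map_mem b⟩ : A)) (Nat.one_div_pos_of_nat (n := p.2) (α := ℝ))
    have hval : ∀ b, (∑ x ∈ K, (characterComp hφ.map_mem x).smulRight
        (star (g x : H →L[ℂ] H) * (g x : H →L[ℂ] H))) b =
        ((∑ x ∈ K, x ⟨φ b, hφ.map_mem b⟩ • (star (g x) * g x) : A) : H →L[ℂ] H) := fun b => by
      simp [sum_apply, characterComp_apply]
    refine ⟨∑ x ∈ K, (characterComp hφ.map_mem x).smulRight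
        (star (g x : H →L[ℂ] H) * (g x : H →L[ℂ] H)), ?_, fun b hb => ?_, ?_⟩
    · clear h1 h2 hval
      induction K using Finset.induction_on with
      | empty => rw [Finset.sum_empty, tilde_zero]; exact isSeparable_zero
      | insert x K hx ih =>
        rw [Finset.sum_insert hx, tilde_add]
        exact (isSeparable_tilde_smulRight e (isState_characterComp hA hφ x) _).add ih
    · rw [hval]
      exact h1 _ (Finset.mem_image_of_mem _ hb)
    · refine ContinuousLinearMap.opNorm_le_bound _ (norm_nonneg φ) fun b => ?_
      rw [hval]
      exact (h2 _).trans (φ.le_opNorm b)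
  choose ψ hψ h1 h2 using key
  refine isClosed_closure.mem_of_tendsto (tendsto_tilde (l := atTop) e h2 fun b => ?_)
    (Eventually.of_forall hψ)
  rw [tendsto_iff_norm_sub_tendsto_zero]
  have h0 : Tendsto (fun p : Finset B × ℕ => 1 / ((p.2 : ℝ) + 1)) atTop (𝓝 0) :=
    (tendsto_one_div_add_atTop_nhds_zero_nat (𝕜 := ℝ)).comp
      (by rw [← prod_atTop_atTop_eq]; exact tendsto_snd)
  refine squeeze_zero' (Eventually.of_forall fun _ => norm_nonneg _) ?_ h0
  filter_upwards [eventually_ge_atTop (({b}, 0) : Finset B × ℕ)] with p hp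
  exact h1 p b (Finset.singleton_subset_iff.1 hp.1)

end Functionals

/-! ### Separability implies abelian range -/

section Functionals

open scoped ComplexOrder

variable {H ι : Type*} [NormedAddCommGroup H] [InnerProductSpace ℂ H]

theorem isTraceRep_rankOne (u v : H) :
    IsTraceRep (InnerProductSpace.rankOne ℂ u v) (Pi.single 0 v) (Pi.single 0 u) := by
  have h0 : ∀ n : ℕ, n ≠ 0 → (Pi.single 0 v : ℕ → H) n = 0 := fun n hn => by simp [hn]
  refine ⟨summable_of_ne_finset_zero (s := {0}) fun n hn => ?_, fun w => ?_⟩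
  · rw [h0 n (by simpa using hn), norm_zero, zero_mul]
  · have := hasSum_single (f := fun n : ℕ => ⟪(Pi.single 0 v : ℕ → H) n, w⟫_ℂ •
      (Pi.single 0 u : ℕ → H) n) 0 fun n hn => by simp [h0 n hn]
    simpa using this

/-- The operator `|u⟩⟨v|` as a trace class operator. -/
def rankOneTraceClass (u v : H) : TraceClass H :=
  ⟨InnerProductSpace.rankOne ℂ u v, _, _, isTraceRep_rankOne u v⟩

theorem toCLM_rankOneTraceClass (u v : H) :
    (rankOneTraceClass u v).toCLM = InnerProductSpace.rankOne ℂ u v := rfl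

variable [CompleteSpace H]

/-- The transpose of `|ū⟩⟨v̄|` is `|v⟩⟨u|`, so conjugated vectors recover the matrix coefficients of
`φ a`. -/
theorem tilde_tmul_rankOne {M : Type*} [NormedRing M] [NormedAlgebra ℂ M]
    (e : HilbertBasis ι ℂ H) (φ : M →L[ℂ] (H →L[ℂ] H)) (a : M) (u v : H) :
    tilde e φ (ProjTensor.tmul a (rankOneTraceClass (conj e u) (conj e v))) =
      ⟪u, φ a v⟫_ℂ := by
  rw [tilde_tmul, toCLM_rankOneTraceClass]
  have h := ((isTraceRep_rankOne (conj e u) (conj e v)).transpose e).comp_left (φ a)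
  rw [(h.trace_spec e).2, tsum_eq_single 0]
  · simp [conj_conj]
  · intro n hn
    simp [hn]

section State

variable {M : Type*} [NormedRing M] [NormedAlgebra ℂ M] [StarRing M] [StarModule ℂ M]
  {σ : M →L[ℂ] ℂ}

theorem IsState.map_star_mul_self_add_smul_one (hσ : IsState σ) (x : M) (t : ℂ) :
    σ (star (x + t • 1) * (x + t • 1)) =
      σ (star x * x) + t * σ (star x) + star t * σ x + star t * t := by
  have : star (x + t • 1) * (x + t • 1) =
      star x * x + t • star x + star t • x + (star t * t) • (1 : M) := by
    simp only [star_add, star_smul, star_one, mul_add, add_mul, smul_mul_assoc, mul_smul_comm,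
      one_mul, mul_one, smul_smul, smul_add, mul_comm t]
    abel
  rw [this]
  simp [hσ.map_one]

/-- The values of the state on squares are real: `t = 1` compares the imaginary parts of `σ x` and
`σ x*`, and `t = i` the real parts. -/
theorem IsState.map_star (hσ : IsState σ) (x : M) : σ (star x) = star (σ x) := by
  have h := hσ.map_star_mul_self_add_smul_one x
  have h0 := (Complex.nonneg_iff.1 (hσ.nonneg x)).2
  have h1 := (Complex.nonneg_iff.1 ((h 1).symm ▸ hσ.nonneg _)).2
  have h2 := (Complex.nonneg_iff.1 ((h Complex.I).symm ▸ hσ.nonneg _)).2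
  simp at h0 h1 h2
  apply Complex.ext <;> simp <;> linarith

/-- The Cauchy–Schwarz inequality for a state. -/
theorem IsState.map_star_mul_map_le (hσ : IsState σ) (x : M) :
    σ (star x) * σ x ≤ σ (star x * x) := by
  have h := hσ.nonneg (x + (-σ x) • 1)
  rw [hσ.map_star_mul_self_add_smul_one] at h
  refine sub_nonneg.1 (h.trans_eq ?_)
  rw [star_neg]
  ring

/-- Positivity of a state is postulated on squares only, so `|u⟩⟨u|` is first factored as `b* b`. -/
theorem IsState.map_rankOne_nonneg {ω : (H →L[ℂ] H) →L[ℂ] ℂ} (hω : IsState ω) (u : H) :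
    0 ≤ ω (InnerProductSpace.rankOne ℂ u u) := by
  have h : 0 ≤ InnerProductSpace.rankOne ℂ u u :=
    (ContinuousLinearMap.nonneg_iff_isPositive _).2 (InnerProductSpace.isPositive_rankOne_self u)
  obtain ⟨b, hb⟩ := CStarAlgebra.nonneg_iff_eq_star_mul_self.1 h
  rw [hb]
  exact hω.nonneg b

/-- The partial transpose of `w* w`, where `w = ⟨u| ⊗ 1 + ⟨v| ⊗ x`. -/
def partialTranspose (x : M) (u v : H) : ProjTensor M (TraceClass H) :=
  ProjTensor.tmul 1 (rankOneTraceClass u u) + ProjTensor.tmul (star x) (rankOneTraceClass u v) +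
    ProjTensor.tmul x (rankOneTraceClass v u) +
      ProjTensor.tmul (star x * x) (rankOneTraceClass v v)

/-- Completing the square with `s = σ x` gives `ω(|u + s v⟩⟨u + s v|) + (σ(x* x) - |s|²) ω(|v⟩⟨v|)`,
whose second term is nonnegative by Cauchy–Schwarz. -/
theorem prodFunctional_partialTranspose_nonneg {ω : (H →L[ℂ] H) →L[ℂ] ℂ} (hσ : IsState σ)
    (hω : IsState ω) (x : M) (u v : H) :
    0 ≤ prodFunctional σ ω (partialTranspose x u v) := by
  have h1 := hω.map_rankOne_nonneg (u + σ x • v)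
  have h2 := mul_nonneg (sub_nonneg.2 (hσ.map_star_mul_map_le x)) (hω.map_rankOne_nonneg v)
  simp only [partialTranspose, map_add, prodFunctional_tmul, toCLM_rankOneTraceClass, hσ.map_one]
  convert add_nonneg h1 h2 using 1
  simp only [map_add, map_smul, map_smulₛₗ, add_apply, smul_apply, smul_eq_mul, hσ.map_star,
    Complex.star_def]
  ring

/-- Separable functionals are positive on partial transposes. -/
theorem IsSeparable.partialTranspose_nonneg {ρ : StrongDual ℂ (ProjTensor M (TraceClass H))}
    (hρ : IsSeparable ρ) (x : M) (u v : H) : 0 ≤ ρ (partialTranspose x u v) := by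
  have hc : IsClosed {ρ : WeakDual ℂ (ProjTensor M (TraceClass H)) |
      0 ≤ ρ (partialTranspose x u v)} :=
    isClosed_le continuous_const (WeakDual.eval_continuous _)
  refine closure_minimal ?_ hc hρ
  rintro _ ⟨ρ, ⟨n, c, σ, ω, h, rfl⟩, rfl⟩
  change 0 ≤ (∑ i, (c i : ℂ) • prodFunctional (σ i) (ω i)) (partialTranspose x u v)
  simp only [sum_apply, smul_apply, smul_eq_mul]
  refine Finset.sum_nonneg fun i _ => mul_nonneg (by exact_mod_cast (h i).1) ?_
  exact prodFunctional_partialTranspose_nonneg (h i).2.1 (h i).2.2.toIsState x u v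

end State

/-- With `u = -x* v`, the first two terms of the partial transpose test cancel and the other two
leave `‖x v‖² - ‖x* v‖²`. -/
theorem norm_adjoint_apply_le_of_isSeparable (e : HilbertBasis ι ℂ H)
    {A B : StarSubalgebra ℂ (H →L[ℂ] H)} (hAB : A ≤ B) {φ : B →L[ℂ] (H →L[ℂ] H)}
    (hφ : IsConditionalExpectation A B φ) (h : IsSeparable (tilde e φ)) {x : H →L[ℂ] H}
    (hx : x ∈ A) (v : H) : ‖x.adjoint v‖ ≤ ‖x v‖ := by
  have h0 := h.partialTranspose_nonneg (⟨x, hAB hx⟩ : B) (conj e (-x.adjoint v)) (conj e v)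
  simp only [partialTranspose, map_add, tilde_tmul_rankOne] at h0
  rw [hφ.map_of_mem 1 (one_mem A), hφ.map_of_mem ⟨x, hAB hx⟩ hx,
    hφ.map_of_mem (star ⟨x, hAB hx⟩) (star_mem hx),
    hφ.map_of_mem (star ⟨x, hAB hx⟩ * ⟨x, hAB hx⟩) (mul_mem (star_mem hx) hx)] at h0
  simp only [MulMemClass.coe_mul, StarMemClass.coe_star, OneMemClass.coe_one, mul_apply_eq_comp,
    one_apply_eq_self, ContinuousLinearMap.star_eq_adjoint, ContinuousLinearMap.adjoint_inner_right,
    inner_neg_left, inner_neg_right, map_neg] at h0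
  rw [← ContinuousLinearMap.adjoint_inner_left x _ v] at h0
  simp only [inner_self_eq_norm_sq_to_K] at h0
  rw [neg_neg, add_neg_cancel, zero_add, neg_add_eq_sub, sub_nonneg] at h0
  have h1 : ‖x.adjoint v‖ ^ 2 ≤ ‖x v‖ ^ 2 := Complex.real_le_real.1 (by push_cast; exact h0)
  exact (sq_le_sq₀ (norm_nonneg _) (norm_nonneg _)).1 h1

theorem commute_of_isSeparable (e : HilbertBasis ι ℂ H)
    {A B : StarSubalgebra ℂ (H →L[ℂ] H)} (hAB : A ≤ B) {φ : B →L[ℂ] (H →L[ℂ] H)}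
    (hφ : IsConditionalExpectation A B φ) (h : IsSeparable (tilde e φ)) :
    ∀ a ∈ A, ∀ b ∈ A, a * b = b * a := by
  have hn : ∀ x ∈ A, star x * x = x * star x := fun x hx => by
    refine (ContinuousLinearMap.isStarNormal_iff_norm_eq_adjoint.2 fun v => ?_).star_comm_self
    refine le_antisymm ?_ (norm_adjoint_apply_le_of_isSeparable e hAB hφ h hx v)
    simpa [ContinuousLinearMap.star_eq_adjoint] using
      norm_adjoint_apply_le_of_isSeparable e hAB hφ h (star_mem hx) v
  -- Polarization: normality of `a + b` and of `a + i b` gives two relations whose sum is `2 b* a =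
  -- 2 a b*`.
  have hs : ∀ a ∈ A, ∀ b ∈ A, star b * a = a * star b := fun a ha b hb => by
    have h1 := hn _ (add_mem ha hb)
    have h2 := hn _ (add_mem ha (SMulMemClass.smul_mem Complex.I hb))
    have ha' := hn a ha
    have hb' := hn b hb
    have h3 := congrArg (fun z => Complex.I • z) h2
    simp only [star_add, star_smul, mul_add, add_mul, smul_mul_assoc, mul_smul_comm, smul_smul,
      Complex.star_def, Complex.conj_I, smul_add, mul_neg, neg_mul, Complex.I_mul_I, neg_neg,
      one_smul, neg_smul, smul_neg] at h1 h3
    rw [ha', hb'] at h1 h3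
    have h4 : star b * a + star a * b = b * star a + a * star b := by
      rw [← sub_eq_zero] at h1 ⊢
      rw [← h1]
      abel
    have h5 : star b * a - star a * b = a * star b - b * star a := by
      rw [← sub_eq_zero] at h3 ⊢
      rw [← h3]
      abel
    have h6 : (2 : ℂ) • (star b * a) = (2 : ℂ) • (a * star b) := by
      rw [two_smul, two_smul]
      have := congrArg₂ (· + ·) h4 h5
      rw [← sub_eq_zero] at this ⊢
      rw [← this]
      abel
    exact smul_right_injective _ (two_ne_zero (α := ℂ)) h6
  intro a ha b hb
  simpa using (hs a ha (star b) (star_mem hb)).symm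

/-! ### Norm closure in finite dimension -/

theorem IsNormSeparable.isSeparable {M : Type*} [NormedRing M] [NormedAlgebra ℂ M] [StarRing M]
    {ρ : StrongDual ℂ (ProjTensor M (TraceClass H))} (hρ : IsNormSeparable ρ) : IsSeparable ρ :=
  image_closure_subset_closure_image NormedSpace.Dual.toWeakDual_continuous ⟨ρ, hρ, rfl⟩

/-- The image of the algebraic tensor product is dense and, being finite dimensional, closed; so it
is the whole completion. -/
theorem finiteDimensional_projTensor (E F : Type*) [SeminormedAddCommGroup E] [NormedSpace ℂ E]
    [SeminormedAddCommGroup F] [NormedSpace ℂ F] [FiniteDimensional ℂ E] [FiniteDimensional ℂ F] :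
    FiniteDimensional ℂ (ProjTensor E F) := by
  have : FiniteDimensional ℂ (AlgTensor E F) :=
    inferInstanceAs (FiniteDimensional ℂ (E ⊗[ℂ] F))
  let f : AlgTensor E F →L[ℂ] ProjTensor E F := UniformSpace.Completion.toComplL
  have hc : IsClosed (LinearMap.range f.toLinearMap : Set (ProjTensor E F)) :=
    Submodule.closed_of_finiteDimensional _
  have hr : Set.range f = Set.univ := by
    have := (UniformSpace.Completion.denseRange_coe (α := AlgTensor E F)).closure_range
    rw [← this]
    exact hc.closure_eq.symm
  exact Module.Finite.of_surjective f.toLinearMap (Set.range_eq_univ.1 hr)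

/-- The weak-star dual is finite dimensional, so the linear identification back to the normed dual
is continuous and carries closures into closures. -/
theorem IsSeparable.isNormSeparable [FiniteDimensional ℂ H] {M : Type*} [NormedRing M]
    [NormedAlgebra ℂ M] [StarRing M] [FiniteDimensional ℂ M]
    {ρ : StrongDual ℂ (ProjTensor M (TraceClass H))} (hρ : IsSeparable ρ) :
    IsNormSeparable ρ := by
  have : FiniteDimensional ℂ (TraceClass H) :=
    Module.Finite.of_injective TraceClass.toCLM TraceClass.toCLM_injective
  have := finiteDimensional_projTensor M (TraceClass H)
  let f : StrongDual ℂ (ProjTensor M (TraceClass H)) ≃ₗ[ℂ]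
    WeakDual ℂ (ProjTensor M (TraceClass H)) := StrongDual.toWeakDual
  have : FiniteDimensional ℂ (WeakDual ℂ (ProjTensor M (TraceClass H))) := f.finiteDimensional
  have hf : Continuous f.symm := f.symm.toLinearMap.continuous_of_finiteDimensional
  have := image_closure_subset_closure_image hf ⟨_, hρ, rfl⟩
  rwa [Set.image_image, Set.image_congr fun ρ _ => f.symm_apply_apply ρ, Set.image_id',
    f.symm_apply_apply] at this

end Functionals

end SepMap

end

theorem mainTheorem8 {H : Type*} [NormedAddCommGroup H] [InnerProductSpace ℂ H] [CompleteSpace H]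
    [TopologicalSpace.SeparableSpace H] {ι : Type*} (e : HilbertBasis ι ℂ H)
    (A B : StarSubalgebra ℂ (H →L[ℂ] H))
    (hA : SepMap.IsCStarSubalgebra A) (hB : SepMap.IsCStarSubalgebra B) (hAB : A ≤ B)
    (φ : B →L[ℂ] (H →L[ℂ] H)) (hφ : SepMap.IsConditionalExpectation A B φ) :
    (SepMap.IsSeparable (SepMap.tilde e φ) ↔ ∀ a ∈ A, ∀ b ∈ A, a * b = b * a) ∧
      (FiniteDimensional ℂ H →
        (SepMap.IsNormSeparable (SepMap.tilde e φ) ↔ ∀ a ∈ A, ∀ b ∈ A, a * b = b * a)) := by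
  have h1 : SepMap.IsSeparable (SepMap.tilde e φ) ↔ ∀ a ∈ A, ∀ b ∈ A, a * b = b * a :=
    ⟨SepMap.commute_of_isSeparable e hAB hφ, SepMap.isSeparable_tilde_of_commute e hA hφ⟩
  refine ⟨h1, fun _ => ⟨fun h => h1.1 h.isSeparable, fun h => ?_⟩⟩
  have : FiniteDimensional ℂ B :=
    inferInstanceAs (FiniteDimensional ℂ (Subalgebra.toSubmodule B.toSubalgebra))
  exact (h1.2 h).isNormSeparable
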